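/- Let $p>2$ be a prime. For $k>1$ let $G_k=(\mathbb Z/p^k)^\times$, let $A_k=\{u\in G_k: u^p=u\}$ (the core), let $B_k=\{u\in G_k: u\equiv 1 \bmod p\}$, and let $F_k=\{u^p: u\in G_k\}$. For an integer $n$ put $d_k(n)=(n+1)^{p^{k-1}}-n^{p^{k-1}}$ (a core increment), and let $D_k=(A_k-A_k)\cap B_k$. Let the critical precision $K_p$ be the smallest $k>1$ such that, for all integers $m,n$ with none of $m,\,m+1,\,n,\,n+1$ divisible by $p$, the congruence $d_k(m)\equiv d_k(n) \bmod p^k$ holds only if $m\equiv n \bmod p$ or $m+n\equiv -1 \bmod p$. For sets $S,T$ of residues, $S\pm T$ and $S\cdot T$ denote the sets of all $s\pm t$ and of all $st$ with $s\in S$, $t\in T$. For every $k>1$, $D_k$ is the set of core increments: $D_k=\{d_k(n) \bmod p^k : 1\le n\le p-2\}$. Moreover: (a) For every $k>1$ and every subgroup $X$ of $G_k$ with $A_k\subseteq X\subseteq F_k$, the pairsums of $X$ that are units form the union of cosets of $X$ generated by $D_k$: $(X+X)\cap G_k=X\cdot D_k$. For $X=A_k$ this accounts for all nonzero pairsums: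 $(A_k+A_k)\setminus\{0\}=A_k\cdot D_k$. (b) For every integer $n$ not divisible by $p$ there is exactly one integer $n'$ with $0\le n'<p$ and $n^{p-1}\equiv n'p+1 \bmod p^2$ (the FST-carry of $n$). For every integer $n'$ satisfying this congruence and all $i\ge 1$, $$(n^{p-1})^{p^{i-1}}\equiv n'p^i+1 \pmod{p^{i+1}}\quad\text{and}\quad n^{p^i}\equiv (n'p^i+1)\,n^{p^{i-1}} \pmod{p^{i+1}}.$$ (c) Modulo $p^p$ there are exactly $|D_p|=(p-1)/2$ distinct core increments, and the critical precision $K_p$ exists and satisfies $K_p<p$. -/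

import Mathlib

open scoped Pointwise

namespace CoreIncrements

/-- The residues modulo `p ^ k` that belong to a subgroup of the unit group `G_k`. -/
def residues {p k : ℕ} (H : Subgroup (ZMod (p ^ k))ˣ) : Set (ZMod (p ^ k)) :=
  (fun u : (ZMod (p ^ k))ˣ => (u : ZMod (p ^ k))) '' (H : Set (ZMod (p ^ k))ˣ)

/-- The core `A_k`: the units `u` modulo `p ^ k` with `u ^ p = u`. -/
def core (p k : ℕ) : Subgroup (ZMod (p ^ k))ˣ where
  carrier := {u | u ^ p = u}
  mul_mem' := by
    intro a b ha hb
    simp only [Set.mem_setOf_eq] at ha hb ⊢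
    rw [mul_pow, ha, hb]
  one_mem' := by simp
  inv_mem' := by
    intro a ha
    simp only [Set.mem_setOf_eq] at ha ⊢
    rw [inv_pow, ha]

/-- The extension group `B_k`: the units modulo `p ^ k` that are `1` modulo `p`. -/
def extensionGroup (p k : ℕ) : Subgroup (ZMod (p ^ k))ˣ where
  carrier := {u | (p : ZMod (p ^ k)) ∣ (u : ZMod (p ^ k)) - 1}
  mul_mem' := by
    intro a b ha hb
    simp only [Set.mem_setOf_eq, Units.val_mul] at ha hb ⊢
    have h := dvd_add (Dvd.dvd.mul_right ha (b : ZMod (p ^ k))) hb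
    have e : ((a : ZMod (p ^ k)) - 1) * b + ((b : ZMod (p ^ k)) - 1) = a * b - 1 := by ring
    rwa [e] at h
  one_mem' := by simp
  inv_mem' := by
    intro a ha
    simp only [Set.mem_setOf_eq] at ha ⊢
    have h := Dvd.dvd.mul_right ha (-((a⁻¹ : (ZMod (p ^ k))ˣ) : ZMod (p ^ k)))
    have e : ((a : ZMod (p ^ k)) - 1) * (-((a⁻¹ : (ZMod (p ^ k))ˣ) : ZMod (p ^ k)))
        = ((a⁻¹ : (ZMod (p ^ k))ˣ) : ZMod (p ^ k)) - 1 := by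
      have h1 : (a : ZMod (p ^ k)) * ((a⁻¹ : (ZMod (p ^ k))ˣ) : ZMod (p ^ k)) = 1 := a.mul_inv
      linear_combination -h1
    rwa [e] at h

/-- The group `F_k` of `p`-th powers of units modulo `p ^ k`. -/
def powerResidues (p k : ℕ) : Subgroup (ZMod (p ^ k))ˣ :=
  (powMonoidHom p : (ZMod (p ^ k))ˣ →* (ZMod (p ^ k))ˣ).range

/-- The set `D_k = (A_k - A_k) ∩ B_k`. -/
def incrementSet (p k : ℕ) : Set (ZMod (p ^ k)) :=
  (residues (core p k) - residues (core p k)) ∩ residues (extensionGroup p k)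

/-- The integer core function `A_k(n) = n ^ (p ^ (k - 1))` (used for `k ≥ 1`). -/
def coreFun (p k : ℕ) (n : ℤ) : ℤ := n ^ (p ^ (k - 1))

/-- The core increment `d_k(n) = A_k(n + 1) - A_k(n)`. -/
def coreIncrement (p k : ℕ) (n : ℤ) : ℤ := coreFun p k (n + 1) - coreFun p k n

/-- `n'` is an FST-carry of `n`: `n ^ (p - 1) ≡ n' p + 1` modulo `p ^ 2`. -/
def IsFSTCarry (p : ℕ) (n n' : ℤ) : Prop :=
  n ^ (p - 1) ≡ n' * p + 1 [ZMOD (p : ℤ) ^ 2]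

/-- The only equivalences modulo `p ^ k` among the core increments `d_k(n)`, with `n` and `n + 1`
prime to `p`, come from the period `p` and the symmetry at `1`-complements. -/
def OnlyComplementSymmetry (p k : ℕ) : Prop :=
  ∀ m n : ℤ, ¬ (p : ℤ) ∣ m → ¬ (p : ℤ) ∣ m + 1 → ¬ (p : ℤ) ∣ n → ¬ (p : ℤ) ∣ n + 1 →
    coreIncrement p k m ≡ coreIncrement p k n [ZMOD (p : ℤ) ^ k] →
      m ≡ n [ZMOD (p : ℤ)] ∨ m + n ≡ -1 [ZMOD (p : ℤ)]

/-- `K` is the critical precision `K_p`: the smallest `k > 1` at which the core increments have no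
equivalences other than those of `1`-complements. -/
def IsCriticalPrecision (p K : ℕ) : Prop :=
  IsLeast {k : ℕ | 1 < k ∧ OnlyComplementSymmetry p k} K

end CoreIncrements

namespace CoreIncrements

/-! ### The core function and its reductions modulo `p` and `p ^ k`. -/

variable {p k : ℕ}

/-! Raising to the power `p ^ (k - 1)` turns congruence mod `p` into congruence mod `p ^ k` and
fixes residues mod `p`, so each nonzero residue has exactly one core lift.

(a) Write `x + y = y (z + 1)` and `z = α b` with `α` in the core and `b ≡ 1` mod `p`. Since `w = (z
+ 1) / (α + 1)` satisfies `b - 1 ∣ w - 1`, cyclicity puts `w` in the group generated by `b`, hence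
in `X` (`mem_zpowers_of_sub_one_dvd`). What remains, `α + 1`, is a core element times an increment.

(b) This is the binomial expansion to first order.

(c) Equal increments give `G^a - G^b - G^c + G^d ≡ 0` mod `p ^ k`, where `G` lifts a primitive root
and is a root of the cyclotomic polynomial `Φ_{p-1}` mod `p ^ k`. So `p ^ k` divides a resultant of
absolute value at most `4 ^ (p - 1)`, which must vanish when `p ≥ 5` and `k ≥ p - 1`. The relation
then holds for a complex root of unity, where `eq_or_eq_or_eq_neg_of_norm_one` leaves only trivial
solutions. -/

theorem coreFun_modEq_of_modEq (hk : 1 ≤ k) {a b : ℤ} (h : a ≡ b [ZMOD (p : ℤ)]) :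
    coreFun p k a ≡ coreFun p k b [ZMOD (p : ℤ) ^ k] := by
  have := dvd_sub_pow_of_dvd_sub (R := ℤ) (p := p) h.symm.dvd (k - 1)
  rw [Nat.sub_add_cancel hk] at this
  exact (Int.modEq_iff_dvd.2 this).symm

theorem pow_prime_modEq (hp : p.Prime) (n : ℤ) : n ^ p ≡ n [ZMOD (p : ℤ)] := by
  have := Fact.mk hp
  rw [← ZMod.intCast_eq_intCast_iff]
  push_cast
  exact ZMod.pow_card _

theorem pow_prime_pow_modEq (hp : p.Prime) (n : ℤ) (j : ℕ) :
    n ^ p ^ j ≡ n [ZMOD (p : ℤ)] := by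
  induction j with
  | zero => simp
  | succ j ih => rw [pow_succ, pow_mul]; exact (pow_prime_modEq hp _).trans ih

theorem coreFun_modEq_self (hp : p.Prime) (n : ℤ) : coreFun p k n ≡ n [ZMOD (p : ℤ)] :=
  pow_prime_pow_modEq hp n _

theorem coreFun_pow_prime_modEq (hp : p.Prime) (hk : 1 ≤ k) (n : ℤ) :
    coreFun p k n ^ p ≡ coreFun p k n [ZMOD (p : ℤ) ^ k] := by
  have := coreFun_modEq_of_modEq hk (pow_prime_modEq hp n)
  simpa only [coreFun, ← pow_mul, mul_comm] using this

theorem intCast_eq_iff_modEq (a b : ℤ) :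
    (a : ZMod (p ^ k)) = b ↔ a ≡ b [ZMOD (p : ℤ) ^ k] := by
  rw [ZMod.intCast_eq_intCast_iff, Nat.cast_pow]

theorem natCast_dvd_intCast_iff (hk : 1 ≤ k) (a : ℤ) :
    (p : ZMod (p ^ k)) ∣ (a : ZMod (p ^ k)) ↔ (p : ℤ) ∣ a := by
  constructor
  · rintro ⟨c, hc⟩
    obtain ⟨c, rfl⟩ := ZMod.intCast_surjective c
    have h : (a : ZMod (p ^ k)) = ((p * c : ℤ) : ZMod (p ^ k)) := by push_cast; exact hc
    rw [intCast_eq_iff_modEq] at h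
    have h' : a ≡ p * c [ZMOD (p : ℤ)] := h.of_dvd (dvd_pow_self _ (by lia))
    exact (Int.dvd_iff_dvd_of_dvd_sub h'.symm.dvd).2 (dvd_mul_right _ _)
  · rintro ⟨c, rfl⟩
    exact ⟨c, by push_cast; rfl⟩

theorem isUnit_intCast_iff (hp : p.Prime) (hk : 1 ≤ k) (a : ℤ) :
    IsUnit (a : ZMod (p ^ k)) ↔ ¬ (p : ℤ) ∣ a := by
  rw [ZMod.coe_int_isUnit_iff_isCoprime, Nat.cast_pow, IsCoprime.pow_left_iff (by lia),
    (Nat.prime_iff_prime_int.1 hp).coprime_iff_not_dvd]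

theorem isUnit_iff_not_dvd (hp : p.Prime) (hk : 1 ≤ k) (x : ZMod (p ^ k)) :
    IsUnit x ↔ ¬ (p : ZMod (p ^ k)) ∣ x := by
  obtain ⟨a, rfl⟩ := ZMod.intCast_surjective x
  rw [isUnit_intCast_iff hp hk, natCast_dvd_intCast_iff hk]

theorem mem_residues_extensionGroup (hp : p.Prime) (hk : 1 ≤ k) (x : ZMod (p ^ k)) :
    x ∈ residues (extensionGroup p k) ↔ (p : ZMod (p ^ k)) ∣ x - 1 := by
  constructor
  · rintro ⟨u, hu, rfl⟩
    exact hu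
  · intro h
    have hx : IsUnit x := by
      rw [isUnit_iff_not_dvd hp hk]
      intro hx
      have h1 : (p : ZMod (p ^ k)) ∣ ((1 : ℤ) : ZMod (p ^ k)) := by
        have := dvd_sub hx h
        simpa using this
      rw [natCast_dvd_intCast_iff hk] at h1
      exact (Nat.prime_iff_prime_int.1 hp).not_dvd_one h1
    exact ⟨hx.unit, h, rfl⟩

theorem pow_prime_pow_mem_core (hp : p.Prime) (hk : 1 ≤ k) (u : (ZMod (p ^ k))ˣ) :
    u ^ p ^ (k - 1) ∈ core p k := by
  obtain ⟨a, ha⟩ := ZMod.intCast_surjective (u : ZMod (p ^ k))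
  apply Units.ext
  push_cast
  rw [← ha]
  have := (intCast_eq_iff_modEq _ _).2 (coreFun_pow_prime_modEq hp hk a)
  simpa [coreFun] using this

theorem pow_prime_pow_eq_of_mem_core {u : (ZMod (p ^ k))ˣ} (hu : u ∈ core p k) (j : ℕ) :
    u ^ p ^ j = u := by
  have hu' : u ^ p = u := hu
  induction j with
  | zero => simp
  | succ j ih => rw [pow_succ, pow_mul, ih, hu']

theorem mem_residues_core (hp : p.Prime) (hk : 1 ≤ k) (x : ZMod (p ^ k)) :
    x ∈ residues (core p k) ↔ ∃ n : ℤ, ¬ (p : ℤ) ∣ n ∧ x = coreFun p k n := by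
  constructor
  · rintro ⟨u, hu, rfl⟩
    obtain ⟨a, ha⟩ := ZMod.intCast_surjective (u : ZMod (p ^ k))
    refine ⟨a, ?_, ?_⟩
    · rw [← isUnit_intCast_iff hp hk, ha]
      exact u.isUnit
    · simp only [coreFun, Int.cast_pow, ha]
      rw [← Units.val_pow_eq_pow_val, pow_prime_pow_eq_of_mem_core hu]
  · rintro ⟨n, hn, rfl⟩
    rw [← isUnit_intCast_iff hp hk] at hn
    refine ⟨hn.unit ^ p ^ (k - 1), pow_prime_pow_mem_core hp hk _, ?_⟩
    simp [coreFun]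

theorem coreIncrement_modEq_of_modEq (hk : 1 ≤ k) {a b : ℤ} (h : a ≡ b [ZMOD (p : ℤ)]) :
    coreIncrement p k a ≡ coreIncrement p k b [ZMOD (p : ℤ) ^ k] :=
  (coreFun_modEq_of_modEq hk (h.add_right 1)).sub (coreFun_modEq_of_modEq hk h)

/-- The core function fixes residues mod `p`, so a difference of core elements is 1 mod `p` exactly
when the underlying residues are consecutive. -/
theorem incrementSet_eq (hp : p.Prime) (hk : 1 ≤ k) :
    incrementSet p k =
      {x | ∃ n : ℤ, 1 ≤ n ∧ n ≤ (p : ℤ) - 2 ∧ x = (coreIncrement p k n : ZMod (p ^ k))} := by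
  have hdvd (a b : ℤ) :
      (p : ZMod (p ^ k)) ∣ (coreFun p k a : ZMod (p ^ k)) - coreFun p k b - 1 ↔
        a ≡ b + 1 [ZMOD (p : ℤ)] := by
    have e : (coreFun p k a : ZMod (p ^ k)) - coreFun p k b - 1 =
        ((coreFun p k a - coreFun p k b - 1 : ℤ) : ZMod (p ^ k)) := by push_cast; ring
    rw [e, natCast_dvd_intCast_iff hk, ← Int.modEq_zero_iff_dvd]
    have h := ((coreFun_modEq_self (k := k) hp a).sub (coreFun_modEq_self (k := k) hp b)).sub_right 1
    constructor
    · intro h'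
      simpa [sub_sub] using (h.symm.trans h').add_right (b + 1)
    · intro h'
      refine h.trans ?_
      simpa [sub_sub] using h'.sub_right (b + 1)
  ext x
  constructor
  · rintro ⟨⟨a, ha, b, hb, rfl⟩, hx⟩
    obtain ⟨m, hm, rfl⟩ := (mem_residues_core hp hk a).1 ha
    obtain ⟨n, hn, rfl⟩ := (mem_residues_core hp hk b).1 hb
    have hmn := (hdvd m n).1 ((mem_residues_extensionGroup hp hk _).1 hx)
    have h0 : (0 : ℤ) < p := by exact_mod_cast hp.pos
    have hnp := Int.mod_modEq n p
    have hn0 : n % p ≠ 0 := fun h ↦ hn (Int.dvd_of_emod_eq_zero h)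
    have hlt := Int.emod_lt_of_pos n h0
    have hge := Int.emod_nonneg n h0.ne'
    have hn1 : n % p ≠ p - 1 := by
      intro h
      apply hm
      rw [← Int.modEq_zero_iff_dvd]
      have h2 := hmn.trans (hnp.symm.add_right 1)
      rw [h, sub_add_cancel] at h2
      exact h2.trans (Int.modEq_zero_iff_dvd.2 dvd_rfl)
    refine ⟨n % p, by lia, by lia, ?_⟩
    rw [(intCast_eq_iff_modEq _ _).2 (coreIncrement_modEq_of_modEq hk hnp)]
    simp only [coreIncrement, Int.cast_sub]
    rw [(intCast_eq_iff_modEq _ _).2 (coreFun_modEq_of_modEq hk hmn)]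
  · rintro ⟨n, h1, h2, rfl⟩
    have hnd {a : ℤ} (h1 : 1 ≤ a) (h2 : a < p) : ¬ (p : ℤ) ∣ a :=
      fun h ↦ absurd (Int.le_of_dvd (by lia) h) (by lia)
    have e : (coreIncrement p k n : ZMod (p ^ k)) =
        (coreFun p k (n + 1) : ZMod (p ^ k)) - coreFun p k n := by
      simp [coreIncrement]
    rw [e]
    refine ⟨⟨_, (mem_residues_core hp hk _).2 ⟨n + 1, hnd (by lia) (by lia), rfl⟩, _,
      (mem_residues_core hp hk _).2 ⟨n, hnd (by lia) (by lia), rfl⟩, rfl⟩, ?_⟩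
    rw [mem_residues_extensionGroup hp hk, hdvd]

/-! ### Cyclic groups and units that are 1 mod `p`. -/

theorem _root_.IsCyclic.mem_zpowers_of_pow_orderOf_eq_one {G : Type*} [Group G] [Finite G]
    [IsCyclic G] {x y : G} (h : y ^ orderOf x = 1) : y ∈ Subgroup.zpowers x := by
  classical
  have := Fintype.ofFinite G
  have hsub : (Subgroup.zpowers x : Set G).toFinset ⊆
      Finset.univ.filter fun a : G ↦ a ^ orderOf x = 1 := by
    intro a ha
    simp only [Set.mem_toFinset, SetLike.mem_coe] at ha
    simp only [Finset.mem_filter, Finset.mem_univ, true_and]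
    exact orderOf_dvd_iff_pow_eq_one.1 (orderOf_dvd_of_mem_zpowers ha)
  have hcard : (Subgroup.zpowers x : Set G).toFinset.card = orderOf x := by
    rw [Set.toFinset_card]
    exact Fintype.card_zpowers
  have heq := Finset.eq_of_subset_of_card_le hsub
    (by rw [hcard]; exact IsCyclic.card_pow_eq_one_le (orderOf_pos x))
  have hy : y ∈ (Subgroup.zpowers x : Set G).toFinset := by
    rw [heq]; simpa using h
  simpa using hy

/-- If `b = 1 + p^m a` with `p ∤ a` and `0 < m < k`, then `b` has order `p^(k-m)`. This power also
kills `w`, which is 1 mod `p^m`, and a cyclic group has only one subgroup of each order. -/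
theorem mem_zpowers_of_sub_one_dvd (hp : p.Prime) (hp2 : 2 < p) (hk : 1 ≤ k)
    {b w : (ZMod (p ^ k))ˣ} (hb : (p : ZMod (p ^ k)) ∣ (b : ZMod (p ^ k)) - 1)
    (hbw : (b : ZMod (p ^ k)) - 1 ∣ (w : ZMod (p ^ k)) - 1) : w ∈ Subgroup.zpowers b := by
  have := ZMod.isCyclic_units_of_prime_pow p hp (by lia) k
  have : NeZero (p ^ k) := ⟨(pow_pos hp.pos k).ne'⟩
  rcases eq_or_ne b 1 with rfl | hb1
  · have hw : w = 1 := Units.ext (by simpa [sub_eq_zero] using hbw)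
    rw [hw]
    exact one_mem _
  apply IsCyclic.mem_zpowers_of_pow_orderOf_eq_one
  obtain ⟨e, he⟩ := ZMod.intCast_surjective ((b : ZMod (p ^ k)) - 1)
  have hek : ¬ (p : ℤ) ^ k ∣ e := by
    intro h
    rw [← Nat.cast_pow, ← ZMod.intCast_zmod_eq_zero_iff_dvd, he, sub_eq_zero] at h
    exact hb1 (Units.ext h)
  have hpe : (p : ℤ) ∣ e := by rwa [← he, natCast_dvd_intCast_iff hk] at hb
  have he0 : e ≠ 0 := by rintro rfl; exact hek (dvd_zero _)
  have hfin : FiniteMultiplicity (p : ℤ) e :=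
    Int.finiteMultiplicity_iff.2 ⟨by simpa using hp.ne_one, he0⟩
  obtain ⟨a, ha, hpa⟩ := hfin.exists_eq_pow_mul_and_not_dvd
  set m := multiplicity (p : ℤ) e
  have hm0 : m ≠ 0 := by
    intro h
    rw [h, pow_zero, one_mul] at ha
    exact hpa (ha ▸ hpe)
  have hmk : m < k := by
    by_contra! h
    exact hek (ha ▸ dvd_mul_of_dvd_left (pow_dvd_pow _ h) _)
  obtain ⟨j, rfl⟩ : ∃ j, k = j + m := ⟨k - m, by lia⟩
  -- Controls the last binomial term `(p^m)^p`; with `m = 1` this needs `p > 2`.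
  have hpm : m + 2 ≤ p * m := by nlinarith [Nat.pos_of_ne_zero hm0]
  have hbe : (b : ZMod (p ^ (j + m))) = 1 + p ^ m * a := by
    rw [eq_add_of_sub_eq he.symm, ha]; push_cast; ring
  have hord : orderOf b = p ^ j := by
    rw [← orderOf_units, hbe]
    exact ZMod.orderOf_one_add_mul_prime_pow hp m hm0 hpm a hpa j
  obtain ⟨s, hs⟩ := hbw
  rw [hord]
  apply Units.ext
  have hw : (w : ZMod (p ^ (j + m))) = 1 + p ^ m * (a * s) := by
    rw [eq_add_of_sub_eq hs, hbe]; ring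
  obtain ⟨y, hy⟩ := ZMod.exists_one_add_mul_pow_prime_pow_eq (R := ZMod (p ^ (j + m)))
    (u := (p : ZMod (p ^ (j + m))) ^ m) (v := p) hp (dvd_pow_self _ hm0)
    (by rw [← pow_succ', ← pow_succ, ← pow_mul, mul_comm]; exact pow_dvd_pow _ hpm) (a * s) j
  rw [Units.val_pow_eq_pow_val, hw, hy, ← pow_add, ← Nat.cast_pow, ZMod.natCast_self]
  simp

/-! ### Pairsums. -/

theorem dvd_pow_prime_pow_sub_self (hp : p.Prime) (hk : 1 ≤ k) (x : ZMod (p ^ k)) (j : ℕ) :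
    (p : ZMod (p ^ k)) ∣ x ^ p ^ j - x := by
  obtain ⟨a, rfl⟩ := ZMod.intCast_surjective x
  have := (pow_prime_pow_modEq hp a j).symm.dvd
  rw [← natCast_dvd_intCast_iff hk] at this
  simpa using this

theorem neg_one_mem_core (hp : p.Prime) (hp2 : 2 < p) : (-1 : (ZMod (p ^ k))ˣ) ∈ core p k :=
  (hp.odd_of_ne_two (by lia)).neg_one_pow

theorem core_eq_of_dvd_sub (hk : 1 ≤ k) {a b : (ZMod (p ^ k))ˣ}
    (ha : a ∈ core p k) (hb : b ∈ core p k)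
    (h : (p : ZMod (p ^ k)) ∣ (a : ZMod (p ^ k)) - b) : a = b := by
  have h1 := dvd_sub_pow_of_dvd_sub h (k - 1)
  rw [Nat.sub_add_cancel hk, ← Nat.cast_pow, ZMod.natCast_self, zero_dvd_iff, sub_eq_zero,
    ← Units.val_pow_eq_pow_val, ← Units.val_pow_eq_pow_val, pow_prime_pow_eq_of_mem_core ha,
    pow_prime_pow_eq_of_mem_core hb] at h1
  exact Units.ext h1

theorem residues_mul_incrementSet_subset (hp : p.Prime) (hp2 : 2 < p)
    {X : Subgroup (ZMod (p ^ k))ˣ} (hX : core p k ≤ X) :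
    residues X * incrementSet p k ⊆ (residues X + residues X) ∩ {x | IsUnit x} := by
  rintro _ ⟨_, ⟨x, hx, rfl⟩, _, ⟨⟨_, ⟨a, ha, rfl⟩, _, ⟨b, hb, rfl⟩, rfl⟩, ⟨v, -, hv⟩⟩, rfl⟩
  refine ⟨⟨_, ⟨x * a, X.mul_mem hx (hX ha), rfl⟩, _, ⟨x * (-1 * b),
    X.mul_mem hx (hX (mul_mem (neg_one_mem_core hp hp2) hb)), rfl⟩, ?_⟩, ?_⟩
  · push_cast
    ring
  · simp only [Set.mem_ofPred_eq]
    simp only at hv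
    rw [← hv]
    exact (x * v).isUnit

theorem mem_residues_mul_incrementSet (hp : p.Prime) (hp2 : 2 < p) (hk : 1 ≤ k)
    {X : Subgroup (ZMod (p ^ k))ˣ} (hX : core p k ≤ X) {x y : (ZMod (p ^ k))ˣ} (hx : x ∈ X)
    (hy : y ∈ X) (hxy : IsUnit ((x : ZMod (p ^ k)) + y)) :
    (x : ZMod (p ^ k)) + y ∈ residues X * incrementSet p k := by
  have hcong (u : (ZMod (p ^ k))ˣ) : (p : ZMod (p ^ k)) ∣ (u ^ p ^ (k - 1) : (ZMod (p ^ k))ˣ) - u := by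
    rw [Units.val_pow_eq_pow_val]
    exact dvd_pow_prime_pow_sub_self hp hk _ _
  set z := x * y⁻¹ with hz
  set α := z ^ p ^ (k - 1) with hα
  have hαc : α ∈ core p k := pow_prime_pow_mem_core hp hk z
  have hαz : (p : ZMod (p ^ k)) ∣ (α : ZMod (p ^ k)) - z := hcong z
  set b := z * α⁻¹ with hb
  have hzα : (z : ZMod (p ^ k)) = α * b := by
    rw [← Units.val_mul, hb, mul_comm z, mul_inv_cancel_left]
  have hxz : (x : ZMod (p ^ k)) = z * y := by
    rw [← Units.val_mul, hz, inv_mul_cancel_right]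
  have hbX : b ∈ X := X.mul_mem (X.mul_mem hx (X.inv_mem hy)) (X.inv_mem (hX hαc))
  have hb1 : (p : ZMod (p ^ k)) ∣ (b : ZMod (p ^ k)) - 1 := by
    have h := (hαz.mul_left (-(α⁻¹ : (ZMod (p ^ k))ˣ) : ZMod (p ^ k)))
    have e : (-(α⁻¹ : (ZMod (p ^ k))ˣ) : ZMod (p ^ k)) * (α - z) = b - 1 := by
      rw [hzα]
      linear_combination ((b : ZMod (p ^ k)) - 1) * α.inv_mul
    rwa [e] at h
  have hz1 : IsUnit ((z : ZMod (p ^ k)) + 1) := by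
    have e : (x : ZMod (p ^ k)) + y = y * (z + 1) := by rw [hxz]; ring
    rw [e] at hxy
    exact isUnit_of_mul_isUnit_right hxy
  have hα1 : IsUnit ((α : ZMod (p ^ k)) + 1) := by
    rw [isUnit_iff_not_dvd hp hk] at hz1 ⊢
    intro h
    apply hz1
    have := dvd_sub h hαz
    rwa [show (α : ZMod (p ^ k)) + 1 - (α - z) = z + 1 by ring] at this
  obtain ⟨β, hβ⟩ := hα1
  set c := β ^ p ^ (k - 1) with hc
  have hcc : c ∈ core p k := pow_prime_pow_mem_core hp hk β
  obtain ⟨ζ, hζ⟩ := hz1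
  set w := ζ * β⁻¹ with hw
  have hζw : (ζ : ZMod (p ^ k)) = w * β := by
    rw [← Units.val_mul, hw, inv_mul_cancel_right]
  have hwX : w ∈ X := by
    refine (Subgroup.zpowers_le.2 hbX) (mem_zpowers_of_sub_one_dvd hp hp2 hk hb1 ?_)
    -- `w - 1 = (z - α) / (α + 1) = (b - 1) α / (α + 1)`.
    refine ⟨α * (β⁻¹ : (ZMod (p ^ k))ˣ), ?_⟩
    rw [hw, Units.val_mul, hζ, hzα]
    linear_combination β.mul_inv -
      ((β⁻¹ : (ZMod (p ^ k))ˣ) : ZMod (p ^ k)) * hβ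
  -- `x + y = y w (α + 1)`; dividing `α + 1` by its core part `c` leaves a unit that is 1 mod `p`,
  -- the difference of the core elements `α / c` and `-1 / c`.
  refine ⟨_, ⟨y * w * c, X.mul_mem (X.mul_mem hy hwX) (hX hcc), rfl⟩,
    ((α * c⁻¹ : (ZMod (p ^ k))ˣ) : ZMod (p ^ k)) - ((-1 * c⁻¹ : (ZMod (p ^ k))ˣ) : ZMod (p ^ k)),
    ⟨⟨_, ⟨_, mul_mem hαc (inv_mem hcc), rfl⟩, _,
      ⟨_, mul_mem (neg_one_mem_core hp hp2) (inv_mem hcc), rfl⟩, rfl⟩, ?_⟩, ?_⟩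
  · rw [mem_residues_extensionGroup hp hk]
    have h := (hcong β).mul_left (-(c⁻¹ : (ZMod (p ^ k))ˣ) : ZMod (p ^ k))
    rw [← hc] at h
    convert! h using 1
    push_cast
    linear_combination (-1 : ZMod (p ^ k)) * ((c⁻¹ : (ZMod (p ^ k))ˣ) : ZMod (p ^ k)) * hβ +
      c.inv_mul
  · push_cast
    linear_combination ((y : ZMod (p ^ k)) * w * (α + 1)) * c.mul_inv - hxz - (y : ZMod (p ^ k)) * w * hβ
      + (y : ZMod (p ^ k)) * (hζ - hζw)

theorem pairsums_inter_units_eq (hp : p.Prime) (hp2 : 2 < p) (hk : 1 ≤ k)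
    {X : Subgroup (ZMod (p ^ k))ˣ} (hX : core p k ≤ X) :
    (residues X + residues X) ∩ {x | IsUnit x} = residues X * incrementSet p k := by
  refine (Set.Subset.antisymm ?_ (residues_mul_incrementSet_subset hp hp2 hX))
  rintro _ ⟨⟨_, ⟨x, hx, rfl⟩, _, ⟨y, hy, rfl⟩, rfl⟩, h⟩
  exact mem_residues_mul_incrementSet hp hp2 hk hX hx hy h

/-- A nonunit sum `x + y` makes the core elements `x` and `-y` congruent mod `p`, hence equal. -/
theorem core_pairsums_diff_zero_eq (hp : p.Prime) (hp2 : 2 < p) (hk : 1 ≤ k) :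
    (residues (core p k) + residues (core p k)) \ {0} =
      residues (core p k) * incrementSet p k := by
  rw [← pairsums_inter_units_eq hp hp2 hk le_rfl]
  ext s
  refine and_congr_right fun hs ↦ ?_
  obtain ⟨_, ⟨x, hx, rfl⟩, _, ⟨y, hy, rfl⟩, rfl⟩ := hs
  simp only [Set.mem_singleton_iff, Set.mem_ofPred_eq, isUnit_iff_not_dvd hp hk]
  refine not_congr ⟨fun h ↦ h ▸ dvd_zero _, fun h ↦ ?_⟩
  have := core_eq_of_dvd_sub hk hx (mul_mem (neg_one_mem_core hp hp2) hy)
    (by simpa using h)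
  rw [this]
  simp

/-! ### FST-carries. -/

theorem existsUnique_isFSTCarry (hp : p.Prime) {n : ℤ} (hn : ¬ (p : ℤ) ∣ n) :
    ∃! n' : ℤ, (0 ≤ n' ∧ n' < p) ∧ IsFSTCarry p n n' := by
  have hp0 : (0 : ℤ) < p := by exact_mod_cast hp.pos
  have h := Int.ModEq.pow_card_sub_one_eq_one hp
    (((Nat.prime_iff_prime_int.1 hp).coprime_iff_not_dvd.2 hn).symm)
  obtain ⟨e, he⟩ := h.symm.dvd
  have key (m : ℤ) : IsFSTCarry p n m ↔ m ≡ e [ZMOD (p : ℤ)] := by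
    rw [IsFSTCarry, eq_add_of_sub_eq he, Int.modEq_comm, Int.modEq_iff_dvd, Int.modEq_iff_dvd,
      show p * e + 1 - (m * p + 1) = p * (e - m) by ring, pow_two,
      mul_dvd_mul_iff_left hp0.ne']
  refine ⟨e % p, ⟨⟨Int.emod_nonneg _ hp0.ne', Int.emod_lt_of_pos _ hp0⟩,
    (key _).2 (Int.mod_modEq _ _)⟩, ?_⟩
  rintro m ⟨⟨h0, h1⟩, hm⟩
  rw [key, Int.ModEq, Int.emod_eq_of_lt h0 h1] at hm
  exact hm

theorem pow_prime_pow_modEq_of_isFSTCarry (hp : p.Prime) (hp2 : 2 < p) {n n' : ℤ}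
    (h : IsFSTCarry p n n') {i : ℕ} (hi : 1 ≤ i) :
    (n ^ (p - 1)) ^ p ^ (i - 1) ≡ n' * (p : ℤ) ^ i + 1 [ZMOD (p : ℤ) ^ (i + 1)] := by
  obtain ⟨t, ht⟩ := h.symm.dvd
  have e : n ^ (p - 1) = 1 + p * (n' + p * t) := by linear_combination ht
  obtain ⟨y, hy⟩ := ZMod.exists_one_add_mul_pow_prime_pow_eq (R := ℤ) (u := p) (v := p) hp dvd_rfl
    (by
      rw [← pow_two, ← pow_succ]
      exact pow_dvd_pow _ hp2) (n' + p * t) (i - 1)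
  rw [e, hy, ← pow_succ, Nat.sub_add_cancel hi]
  refine Int.modEq_iff_dvd.2 ⟨-(t + y), ?_⟩
  ring

theorem pow_prime_pow_modEq_carry_mul (hp : p.Prime) (hp2 : 2 < p) {n n' : ℤ}
    (h : IsFSTCarry p n n') {i : ℕ} (hi : 1 ≤ i) :
    n ^ p ^ i ≡ (n' * (p : ℤ) ^ i + 1) * n ^ p ^ (i - 1) [ZMOD (p : ℤ) ^ (i + 1)] := by
  have e : n ^ p ^ i = (n ^ (p - 1)) ^ p ^ (i - 1) * n ^ p ^ (i - 1) := by
    rw [← pow_mul, ← pow_add]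
    congr 1
    obtain ⟨j, rfl⟩ : ∃ j, i = j + 1 := ⟨i - 1, by lia⟩
    rw [Nat.add_sub_cancel, ← Nat.succ_mul, Nat.succ_eq_add_one, Nat.sub_add_cancel hp.one_le,
      pow_succ']
  rw [e]
  exact (pow_prime_pow_modEq_of_isFSTCarry hp hp2 h hi).mul_right _

/-! ### From congruences mod `p ^ k` to complex roots of unity. -/

open Polynomial

/-- The resultant of `Φ_N` and `f` is an integer combination of their values at `G`, so `M` divides
it. It is also the product of the values of `f` at the primitive roots, so it is smaller than `M`
and vanishes. -/
theorem exists_primitiveRoot_aeval_eq_zero {N M : ℕ} (hN : 1 < N) {G : ℤ} {f : ℤ[X]}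
    (hΦ : (M : ℤ) ∣ (cyclotomic N ℤ).eval G) (hf : (M : ℤ) ∣ f.eval G) {B : ℝ} (hB : 1 ≤ B)
    (hfB : ∀ ζ : ℂ, IsPrimitiveRoot ζ N → ‖aeval ζ f‖ ≤ B) (hBM : B ^ N < M) :
    ∃ ζ : ℂ, IsPrimitiveRoot ζ N ∧ aeval ζ f = 0 := by
  have hN0 : 0 < N := by lia
  have hdeg : (cyclotomic N ℤ).natDegree ≠ 0 := by
    rw [natDegree_cyclotomic]
    exact (Nat.totient_pos.2 hN0).ne'
  obtain ⟨u, v, -, -, huv⟩ := exists_mul_add_mul_eq_C_resultant (cyclotomic N ℤ) f le_rfl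
    (le_refl f.natDegree) (Or.inl hdeg)
  set R := resultant (cyclotomic N ℤ) f with hR
  have hMR : (M : ℤ) ∣ R := by
    have := congrArg (eval G) huv
    rw [eval_add, eval_mul, eval_mul, eval_C] at this
    rw [← this]
    exact dvd_add (hΦ.mul_right _) (hf.mul_right _)
  have hcast : (R : ℂ) = ((cyclotomic N ℂ).roots.map fun ζ ↦ aeval ζ f).prod := by
    have h1 := resultant_map_map (cyclotomic N ℤ) f (cyclotomic N ℤ).natDegree f.natDegree
      (Int.castRingHom ℂ)
    rw [map_cyclotomic] at h1
    have h2 := resultant_eq_prod_eval (cyclotomic N ℂ) (f.map (Int.castRingHom ℂ)) f.natDegree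
      natDegree_map_le (IsAlgClosed.splits _)
    rw [natDegree_cyclotomic] at h1 h2
    rw [h2, (cyclotomic.monic N ℂ).leadingCoeff, one_pow, one_mul] at h1
    rw [hR, natDegree_cyclotomic]
    simpa [aeval_def, eval_map, eq_comm] using h1
  have hroot {ζ : ℂ} (h : ζ ∈ (cyclotomic N ℂ).roots) : IsPrimitiveRoot ζ N :=
    (isRoot_cyclotomic_iff_charZero hN0).1 (isRoot_of_mem_roots h)
  have hnorm : ‖(R : ℂ)‖ ≤ B ^ N := by
    have : NeZero N := ⟨hN0.ne'⟩
    rw [hcast, cyclotomic.roots_eq_primitiveRoots_val]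
    change ‖∏ ζ ∈ primitiveRoots N ℂ, aeval ζ f‖ ≤ _
    rw [norm_prod]
    refine (Finset.prod_le_prod (fun _ _ ↦ norm_nonneg _)
      fun ζ hζ ↦ hfB ζ ((mem_primitiveRoots hN0).1 hζ)).trans ?_
    rw [Finset.prod_const, Complex.card_primitiveRoots]
    exact pow_le_pow_right₀ hB (Nat.totient_le N)
  have hR0 : R = 0 := by
    by_contra h
    have h1 := Int.le_of_dvd (abs_pos.2 h) ((dvd_abs _ _).2 hMR)
    have h2 : (M : ℝ) ≤ |(R : ℝ)| := by exact_mod_cast h1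
    rw [Complex.norm_intCast] at hnorm
    linarith
  rw [hR0, Int.cast_zero, eq_comm, Multiset.prod_eq_zero_iff, Multiset.mem_map] at hcast
  obtain ⟨ζ, hζ, h0⟩ := hcast
  exact ⟨ζ, hroot hζ, h0⟩

/-- Conjugation inverts unit complex numbers, so two pairs with the same nonzero sum also have the
same product, and thus coincide. -/
theorem eq_or_eq_or_eq_neg_of_norm_one {a b c d : ℂ} (ha : ‖a‖ = 1) (hb : ‖b‖ = 1)
    (hc : ‖c‖ = 1) (hd : ‖d‖ = 1) (h : a + d = b + c) : a = b ∨ a = c ∨ a = -d := by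
  have hconj := congrArg (starRingEnd ℂ) h
  have ne {z : ℂ} (hz : ‖z‖ = 1) : z ≠ 0 := by
    rintro rfl
    simp at hz
  simp only [map_add, ← Complex.inv_eq_conj ha, ← Complex.inv_eq_conj hb,
    ← Complex.inv_eq_conj hc, ← Complex.inv_eq_conj hd] at hconj
  have ha0 := ne ha
  have hb0 := ne hb
  have hc0 := ne hc
  have hd0 := ne hd
  field_simp at hconj
  by_cases h0 : a + d = 0
  · exact Or.inr (Or.inr (eq_neg_of_add_eq_zero_left h0))
  have h1 : (a + d) * (b * c - a * d) = 0 := by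
    linear_combination hconj - a * d * h
  have h2 := (mul_eq_zero.1 h1).resolve_left h0
  have h3 : (a - b) * (a - c) = 0 := by
    linear_combination h2 + a * h
  rcases mul_eq_zero.1 h3 with h | h
  · exact Or.inl (sub_eq_zero.1 h)
  · exact Or.inr (Or.inl (sub_eq_zero.1 h))

theorem exists_int_primitiveRoot (hp : p.Prime) : ∃ g : ℤ, ¬ (p : ℤ) ∣ g ∧
    IsPrimitiveRoot (g : ZMod p) (p - 1) ∧
    ∀ n : ℤ, ¬ (p : ℤ) ∣ n → ∃ i : ℕ, n ≡ g ^ i [ZMOD (p : ℤ)] := by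
  have := Fact.mk hp
  obtain ⟨γ, hγ⟩ := IsCyclic.exists_generator (α := (ZMod p)ˣ)
  obtain ⟨g, hg⟩ := ZMod.intCast_surjective (γ : ZMod p)
  refine ⟨g, ?_, ?_, fun n hn ↦ ?_⟩
  · rw [← ZMod.intCast_zmod_eq_zero_iff_dvd, hg]
    exact γ.ne_zero
  · rw [hg, IsPrimitiveRoot.coe_units_iff, ← ZMod.card_units p, ← Nat.card_eq_fintype_card,
      ← orderOf_eq_card_of_forall_mem_zpowers hγ]
    exact IsPrimitiveRoot.orderOf γ
  · rw [← ZMod.intCast_zmod_eq_zero_iff_dvd] at hn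
    obtain ⟨i, hi⟩ := mem_powers_iff_mem_zpowers.2 (hγ (Units.mk0 _ hn))
    refine ⟨i, ?_⟩
    rw [← ZMod.intCast_eq_intCast_iff, Int.cast_pow, hg, ← Units.val_pow_eq_pow_val]
    simp only at hi
    rw [hi]
    rfl

/-- `p ^ k` divides `G^(p-1) - 1`, the product of the `Φ_d(G)`. Those with `d < p - 1` are prime to
`p`, as `g` has exact order `p - 1`. -/
theorem pow_dvd_cyclotomic_eval (hp : p.Prime) (hp2 : 2 < p) (hk : 1 ≤ k) {g : ℤ}
    (hg0 : ¬ (p : ℤ) ∣ g) (hg : IsPrimitiveRoot (g : ZMod p) (p - 1)) :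
    (p : ℤ) ^ k ∣ (cyclotomic (p - 1) ℤ).eval (coreFun p k g) := by
  have := Fact.mk hp
  have hpos : 0 < p - 1 := by lia
  have hprod := congrArg (eval (coreFun p k g)) (prod_cyclotomic_eq_X_pow_sub_one hpos ℤ)
  rw [eval_prod, ← Finset.mul_prod_erase _ _ (Nat.mem_divisors_self _ hpos.ne')] at hprod
  have hone : coreFun p k g ^ (p - 1) ≡ 1 [ZMOD (p : ℤ) ^ k] := by
    have h := Int.ModEq.pow_card_sub_one_eq_one hp
      (((Nat.prime_iff_prime_int.1 hp).coprime_iff_not_dvd.2 hg0).symm)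
    have h1 := coreFun_modEq_of_modEq hk h
    simpa only [coreFun, one_pow, ← pow_mul, mul_comm] using h1
  have hdvd : (p : ℤ) ^ k ∣ (cyclotomic (p - 1) ℤ).eval (coreFun p k g) *
      ∏ d ∈ (p - 1).divisors.erase (p - 1), (cyclotomic d ℤ).eval (coreFun p k g) := by
    rw [hprod]
    simpa using hone.symm.dvd
  refine IsCoprime.dvd_of_dvd_mul_right ?_ hdvd
  refine IsCoprime.pow_left (IsCoprime.prod_right fun d hd ↦ ?_)
  rw [(Nat.prime_iff_prime_int.1 hp).coprime_iff_not_dvd]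
  intro h
  rw [Finset.mem_erase, Nat.mem_divisors] at hd
  have h1 := h.trans (eval_dvd (cyclotomic.dvd_X_pow_sub_one d ℤ))
  have h2 : g ^ d ≡ 1 [ZMOD (p : ℤ)] := by
    refine ((coreFun_modEq_self (k := k) hp g).symm.pow d).trans ?_
    exact (Int.modEq_iff_dvd.2 (by simpa using h1)).symm
  rw [← ZMod.intCast_eq_intCast_iff, Int.cast_pow, Int.cast_one] at h2
  have h3 := hg.dvd_of_pow_eq_one _ h2
  exact hd.1 (Nat.dvd_antisymm hd.2.1 h3)

/-! ### Complement symmetry and the critical precision. -/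

theorem modEq_or_add_modEq_of_coreIncrement_modEq (hp : p.Prime) (hp2 : 2 < p) (hk : p - 1 ≤ k)
    {m n : ℤ} (hm : ¬ (p : ℤ) ∣ m) (hm1 : ¬ (p : ℤ) ∣ m + 1) (hn : ¬ (p : ℤ) ∣ n)
    (hn1 : ¬ (p : ℤ) ∣ n + 1)
    (h : coreIncrement p k m ≡ coreIncrement p k n [ZMOD (p : ℤ) ^ k]) :
    m ≡ n [ZMOD (p : ℤ)] ∨ m + n ≡ -1 [ZMOD (p : ℤ)] := by
  have := Fact.mk hp
  -- For `p = 3` the bound `4 ^ (p - 1) < p ^ k` fails at `k = 2`, but then `m ≡ n ≡ 1` is forced.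
  rcases (show 3 ≤ p from hp2).eq_or_lt with rfl | hp3
  · left
    rw [Int.ModEq]
    push_cast at *
    lia
  have hp5 : 4 < p := by
    by_contra! h4
    obtain rfl : p = 4 := by lia
    exact absurd hp (by norm_num)
  have hk1 : 1 ≤ k := by lia
  obtain ⟨g, hg0, hg, hgen⟩ := exists_int_primitiveRoot hp
  obtain ⟨a, ha⟩ := hgen _ hm1
  obtain ⟨b, hb⟩ := hgen _ hm
  obtain ⟨c, hc⟩ := hgen _ hn1
  obtain ⟨d, hd⟩ := hgen _ hn
  have hcore {x : ℤ} {i : ℕ} (hx : x ≡ g ^ i [ZMOD (p : ℤ)]) :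
      coreFun p k x ≡ coreFun p k g ^ i [ZMOD (p : ℤ) ^ k] := by
    have h1 := coreFun_modEq_of_modEq hk1 hx
    simpa only [coreFun, ← pow_mul, mul_comm] using h1
  have hf : (p : ℤ) ^ k ∣ (X ^ a - X ^ b - X ^ c + X ^ d : ℤ[X]).eval (coreFun p k g) := by
    have h1 := (((hcore ha).sub (hcore hb)).symm.trans (h.trans ((hcore hc).sub (hcore hd))))
    have h2 := h1.symm.dvd
    convert! h2 using 1
    simp only [eval_add, eval_sub, eval_pow, eval_X]
    ring
  have hunit {ζ : ℂ} (hζ : IsPrimitiveRoot ζ (p - 1)) (i : ℕ) : ‖ζ ^ i‖ = 1 := by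
    rw [norm_pow, hζ.norm'_eq_one (by lia), one_pow]
  obtain ⟨ζ, hζ, h0⟩ := exists_primitiveRoot_aeval_eq_zero (N := p - 1) (M := p ^ k) (by lia)
    (B := 4) (by exact_mod_cast pow_dvd_cyclotomic_eval hp hp2 hk1 hg0 hg)
    (by exact_mod_cast hf) (by norm_num)
    (fun ζ hζ ↦ by
      simp only [map_add, map_sub, map_pow, aeval_X]
      refine (norm_add_le _ _).trans ?_
      have h1 := norm_sub_le (ζ ^ a - ζ ^ b) (ζ ^ c)
      have h2 := norm_sub_le (ζ ^ a) (ζ ^ b)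
      rw [hunit hζ] at *
      rw [hunit hζ] at h2
      linarith [hunit hζ a])
    (by
      have h1 : 4 ^ (p - 1) < p ^ k :=
        (Nat.pow_lt_pow_left hp5 (by lia)).trans_le (Nat.pow_le_pow_right hp.pos hk)
      exact_mod_cast h1)
  -- Both `ζ` and `g` mod `p` have order `p - 1`.
  have htransfer (i j : ℕ) : ζ ^ i = ζ ^ j ↔ g ^ i ≡ g ^ j [ZMOD (p : ℤ)] := by
    rw [← ZMod.intCast_eq_intCast_iff, Int.cast_pow, Int.cast_pow,
      (hζ.isOfFinOrder (by lia)).pow_inj_mod, (hg.isOfFinOrder (by lia)).pow_inj_mod,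
      ← hζ.eq_orderOf, ← hg.eq_orderOf]
  simp only [map_add, map_sub, map_pow, aeval_X] at h0
  rcases eq_or_eq_or_eq_neg_of_norm_one (hunit hζ a) (hunit hζ b) (hunit hζ c) (hunit hζ d)
    (by linear_combination h0) with h1 | h1 | h1
  · rw [htransfer] at h1
    have h2 := (ha.trans h1).trans hb.symm
    have h3 : (p : ℤ) ∣ 1 := by simpa using h2.symm.dvd
    exact absurd h3 (Nat.prime_iff_prime_int.1 hp).not_dvd_one
  · rw [htransfer] at h1
    exact Or.inl (Int.ModEq.add_right_cancel' 1 ((ha.trans h1).trans hc.symm))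
  · right
    -- Only equalities of powers transfer, so the sign in `ζ^a = -ζ^d` is carried over by squaring
    -- and excluding `g^a ≡ g^d`.
    have hsq : ζ ^ (2 * a) = ζ ^ (2 * d) := by
      rw [mul_comm 2, mul_comm 2, pow_mul, pow_mul, h1, neg_sq]
    rw [htransfer] at hsq
    have hne : ¬ g ^ a ≡ g ^ d [ZMOD (p : ℤ)] := by
      rw [← htransfer, h1]
      intro h2
      have h3 : ζ ^ d = 0 := by linear_combination (-1 / 2 : ℂ) * h2
      have h4 := hunit hζ d
      rw [h3, norm_zero] at h4
      exact zero_ne_one h4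
    have hdvd : (p : ℤ) ∣ (g ^ a - g ^ d) * (g ^ a + g ^ d) := by
      have h2 := hsq.symm.dvd
      convert! h2 using 1
      ring
    rcases (Nat.prime_iff_prime_int.1 hp).dvd_or_dvd hdvd with h2 | h2
    · exact absurd (Int.modEq_iff_dvd.2 h2).symm hne
    · have h3 := (ha.add hd).trans (Int.modEq_zero_iff_dvd.2 h2)
      have h4 := h3.sub_right 1
      convert! h4 using 1
      ring

theorem coreIncrement_neg_one_sub (hp : p.Prime) (hp2 : 2 < p) (n : ℤ) :
    coreIncrement p k (-1 - n) = coreIncrement p k n := by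
  have hodd : Odd (p ^ (k - 1)) := (hp.odd_of_ne_two (by lia)).pow
  simp only [coreIncrement, coreFun]
  rw [show (-1 - n + 1 : ℤ) = -n by ring, show (-1 - n : ℤ) = -(n + 1) by ring, hodd.neg_pow,
    hodd.neg_pow]
  ring

/-- The symmetry `n ↦ p - 1 - n` folds the range onto `1, …, (p - 1) / 2`, where no further
coincidences occur. -/
theorem incrementSet_ncard (hp : p.Prime) (hp2 : 2 < p) (hk : p - 1 ≤ k) :
    (incrementSet p k).ncard = (p - 1) / 2 := by
  have hk1 : 1 ≤ k := by lia
  have hodd := hp.odd_of_ne_two (by lia)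
  obtain ⟨r, hr⟩ := hodd
  have hr' : (p : ℤ) = 2 * r + 1 := by exact_mod_cast hr
  have himg : incrementSet p k =
      (fun n : ℤ ↦ (coreIncrement p k n : ZMod (p ^ k))) '' (Finset.Icc (1 : ℤ) r : Set ℤ) := by
    rw [incrementSet_eq hp hk1]
    ext x
    simp only [Set.mem_ofPred_eq, Set.mem_image, Finset.coe_Icc, Set.mem_Icc]
    constructor
    · rintro ⟨n, h1, h2, rfl⟩
      rcases le_or_gt n r with hnr | hnr
      · exact ⟨n, ⟨h1, hnr⟩, rfl⟩
      · refine ⟨p - 1 - n, ⟨by lia, by lia⟩, ?_⟩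
        rw [intCast_eq_iff_modEq, ← coreIncrement_neg_one_sub hp hp2 n]
        apply coreIncrement_modEq_of_modEq hk1
        exact Int.modEq_iff_dvd.2 ⟨-1, by ring⟩
    · rintro ⟨n, ⟨h1, h2⟩, rfl⟩
      exact ⟨n, h1, by lia, rfl⟩
  have hnd {a : ℤ} (h1 : 1 ≤ a) (h2 : a < p) : ¬ (p : ℤ) ∣ a :=
    fun h ↦ absurd (Int.le_of_dvd (by lia) h) (by lia)
  rw [himg, Set.InjOn.ncard_image, Set.ncard_coe_finset, Int.card_Icc]
  · lia
  · intro m hm n hn hmn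
    simp only [Finset.coe_Icc, Set.mem_Icc] at hm hn
    have hmn' := (intCast_eq_iff_modEq _ _).1 hmn
    rcases modEq_or_add_modEq_of_coreIncrement_modEq hp hp2 hk (hnd hm.1 (by lia))
      (hnd (by lia) (by lia)) (hnd hn.1 (by lia)) (hnd (by lia) (by lia)) hmn' with h | h
    · rwa [Int.ModEq, Int.emod_eq_of_lt (by lia) (by lia), Int.emod_eq_of_lt (by lia) (by lia)] at h
    · have h1 : m + n + 1 ≡ 0 [ZMOD (p : ℤ)] := by simpa using h.add_right 1
      have h2 := Int.le_of_dvd (by lia) (Int.modEq_zero_iff_dvd.1 h1)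
      lia

theorem exists_isCriticalPrecision (hp : p.Prime) (hp2 : 2 < p) :
    ∃ K : ℕ, IsCriticalPrecision p K ∧ K < p := by
  have hmem : p - 1 ∈ {k : ℕ | 1 < k ∧ OnlyComplementSymmetry p k} :=
    ⟨by lia, fun _ _ hm hm1 hn hn1 h ↦
      modEq_or_add_modEq_of_coreIncrement_modEq hp hp2 le_rfl hm hm1 hn hn1 h⟩
  refine ⟨sInf {k : ℕ | 1 < k ∧ OnlyComplementSymmetry p k},
    ⟨Nat.sInf_mem ⟨_, hmem⟩, fun _ h ↦ Nat.sInf_le h⟩, (Nat.sInf_le hmem).trans_lt (by lia)⟩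

end CoreIncrements

theorem lemma3p1 (p : ℕ) (hp : p.Prime) (hp2 : 2 < p) :
    -- the set `D_k` consists of the core increments
    (∀ k : ℕ, 1 < k →
      CoreIncrements.incrementSet p k =
        {x | ∃ n : ℤ, 1 ≤ n ∧ n ≤ (p : ℤ) - 2 ∧
          x = (CoreIncrements.coreIncrement p k n : ZMod (p ^ k))}) ∧
    -- (a)
    (∀ k : ℕ, 1 < k →
      (∀ X : Subgroup (ZMod (p ^ k))ˣ,
        CoreIncrements.core p k ≤ X → X ≤ CoreIncrements.powerResidues p k →
          (CoreIncrements.residues X + CoreIncrements.residues X) ∩ {x | IsUnit x} =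
            CoreIncrements.residues X * CoreIncrements.incrementSet p k) ∧
      (CoreIncrements.residues (CoreIncrements.core p k) +
          CoreIncrements.residues (CoreIncrements.core p k)) \ {0} =
        CoreIncrements.residues (CoreIncrements.core p k) * CoreIncrements.incrementSet p k) ∧
    -- (b)
    (∀ n : ℤ, ¬ (p : ℤ) ∣ n →
      (∃! n' : ℤ, (0 ≤ n' ∧ n' < p) ∧ CoreIncrements.IsFSTCarry p n n') ∧
      ∀ n' : ℤ, CoreIncrements.IsFSTCarry p n n' → ∀ i : ℕ, 1 ≤ i →
        (n ^ (p - 1)) ^ (p ^ (i - 1)) ≡ n' * (p : ℤ) ^ i + 1 [ZMOD (p : ℤ) ^ (i + 1)] ∧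
        n ^ (p ^ i) ≡ (n' * (p : ℤ) ^ i + 1) * n ^ (p ^ (i - 1)) [ZMOD (p : ℤ) ^ (i + 1)]) ∧
    -- (c)
    ((CoreIncrements.incrementSet p p).ncard = (p - 1) / 2 ∧
      ∃ K : ℕ, CoreIncrements.IsCriticalPrecision p K ∧ K < p) := by
  refine ⟨fun k hk ↦ CoreIncrements.incrementSet_eq hp hk.le, fun k hk ↦ ⟨fun X hX _ ↦
    CoreIncrements.pairsums_inter_units_eq hp hp2 hk.le hX,
    CoreIncrements.core_pairsums_diff_zero_eq hp hp2 hk.le⟩, fun n hn ↦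
    ⟨CoreIncrements.existsUnique_isFSTCarry hp hn, fun n' hn' i hi ↦
      ⟨CoreIncrements.pow_prime_pow_modEq_of_isFSTCarry hp hp2 hn' hi,
        CoreIncrements.pow_prime_pow_modEq_carry_mul hp hp2 hn' hi⟩⟩,
    CoreIncrements.incrementSet_ncard hp hp2 (Nat.sub_le p 1),
    CoreIncrements.exists_isCriticalPrecision hp hp2⟩
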